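/- Let $G$ be a finite tree with $\operatorname{diam}(G)\le 5$, and let $r\ge 2$ be an integer. Let $\mathrm{Ind}_r(G)$ be the simplicial complex on $V(G)$ whose faces are the sets $A\subseteq V(G)$ such that every connected component of the induced subgraph $G[A]$ has at most $r$ vertices. Then $\mathrm{Ind}_r(G)$ is shellable, that is, its facets can be ordered $F_1,\dots,F_t$ (without repetition) so that for each $k>1$ the complex $\langle F_k\rangle\cap\langle F_1,\dots,F_{k-1}\rangle$ is pure of dimension $\dim F_k-1$. Here $\langle\mathcal F\rangle$ denotes the simplicial complex of all subsets of members of $\mathcal F$; the empty set is a face, of dimension $-1$. -/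

import Mathlib

namespace PreAbstractSimplicialComplex

/-- The facets of a complex, that is, its maximal faces. Mathlib's (pre-)abstract simplicial
complexes do not list the empty face, which is a face of every complex here; it is put back, so
that the complex without nonempty faces is `{∅}`, of dimension `-1`, with the single facet `∅`. -/
def facets {V : Type*} (K : PreAbstractSimplicialComplex V) : Set (Finset V) :=
  {F | Maximal (fun s => s = ∅ ∨ s ∈ K.faces) F}

/-- The complex `⟨𝓕⟩` generated by a family `𝓕` of finite sets: its (nonempty) faces are the
nonempty subsets of the members of `𝓕`. -/
def generatedBy {V : Type*} (𝓕 : Set (Finset V)) : PreAbstractSimplicialComplex V where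
  faces := {s | s.Nonempty ∧ ∃ F ∈ 𝓕, s ⊆ F}
  isRelLowerSet_faces := fun _ ⟨hs, F, hF, hsF⟩ =>
    ⟨hs, fun _ hts ht => ⟨ht, F, hF, Finset.Subset.trans hts hsF⟩⟩

/-- The dimension of a face. -/
def dimFace {V : Type*} (s : Finset V) : ℤ := (s.card : ℤ) - 1

/-- A complex is pure of dimension `d` if all of its facets have dimension `d`. -/
def IsPureOfDim {V : Type*} (K : PreAbstractSimplicialComplex V) (d : ℤ) : Prop :=
  ∀ F ∈ K.facets, dimFace F = d

/-- (Nonpure) shellability: the facets can be listed without repetition as `F 0, …, F (t - 1)` in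
such a way that, for each `k > 0`, the complex `⟨F k⟩ ∩ ⟨F 0, …, F (k - 1)⟩` is pure of dimension
`dim (F k) - 1`. -/
def IsShellable {V : Type*} (K : PreAbstractSimplicialComplex V) : Prop :=
  ∃ (t : ℕ) (F : Fin t → Finset V),
    Function.Injective F ∧ Set.range F = K.facets ∧
      ∀ k : Fin t, 0 < (k : ℕ) →
        IsPureOfDim (generatedBy {F k} ⊓ generatedBy (F '' {j | j < k})) (dimFace (F k) - 1)

end PreAbstractSimplicialComplex

namespace SimpleGraph

/-- A finite set `A` of vertices is `r`-independent if every connected component of the induced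
subgraph `G[A]` has at most `r` vertices. -/
def IsRIndependent {V : Type*} (G : SimpleGraph V) (r : ℕ) (A : Finset V) : Prop :=
  ∀ C : (G.induce (A : Set V)).ConnectedComponent, C.supp.ncard ≤ r

theorem IsRIndependent.mono {V : Type*} {G : SimpleGraph V} {r : ℕ} {A B : Finset V}
    (hA : G.IsRIndependent r A) (hBA : B ⊆ A) : G.IsRIndependent r B := by
  intro C
  have hle : (B : Set V) ≤ (A : Set V) := fun x hx => hBA hx
  let φ := G.induceHomOfLE hle
  have hsub : φ '' C.supp ⊆ (C.map φ.toHom).supp := by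
    rintro _ ⟨x, hx, rfl⟩
    rw [ConnectedComponent.mem_supp_iff] at hx ⊢
    rw [← hx]
    rfl
  calc C.supp.ncard = (φ '' C.supp).ncard := (Set.ncard_image_of_injective _ φ.injective).symm
    _ ≤ (C.map φ.toHom).supp.ncard := Set.ncard_le_ncard hsub (Set.toFinite _)
    _ ≤ r := hA _

theorem isRIndependent_of_card_le {V : Type*} (G : SimpleGraph V) {r : ℕ} {A : Finset V}
    (hA : A.card ≤ r) : G.IsRIndependent r A := by
  intro C
  calc C.supp.ncard ≤ (Set.univ : Set (A : Set V)).ncard :=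
        Set.ncard_le_ncard (Set.subset_univ _) (Set.toFinite _)
    _ = A.card := by simp
    _ ≤ r := hA

/-- The `r`-independence complex `Ind_r(G)`, for `r ≥ 1`: its faces are the `r`-independent sets of
vertices (Mathlib's complexes list only the nonempty faces). -/
def rIndependenceComplex {V : Type*} (G : SimpleGraph V) (r : ℕ) (hr : 1 ≤ r) :
    AbstractSimplicialComplex V where
  faces := {A | A.Nonempty ∧ G.IsRIndependent r A}
  isRelLowerSet_faces := fun _ ⟨hA, hAr⟩ => ⟨hA, fun _ hBA hB => ⟨hB, hAr.mono hBA⟩⟩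
  singleton_mem := fun v =>
    ⟨Finset.singleton_nonempty v, G.isRIndependent_of_card_le (by simpa using hr)⟩

end SimpleGraph

/-! The complex is shown to be vertex decomposable. Deleting vertices and taking links in `Ind_r(G)`
gives complexes of those `A ⊆ U` with `A ∪ S` `r`-independent, where `S` holds the forced vertices
and `W = U ∪ S` the remaining ones. If `S` is not `r`-independent there are no faces, and if `W` is
`r`-independent there is one facet. Otherwise a vertex `x ∈ U` is needed such that no facet of the
deletion of `x` lies in its link; induction on `|U|` then concludes by
`IsRankShellable.of_shedding`.

The diameter bound gives a tree with at least two vertices an edge `ab` with every vertex within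
distance two of `{a, b}`. A branch is a vertex at distance one with its children, which are leaves.
The vertex `x` is found as follows. A branch with more than `r` vertices yields its centre if that
is free, and one of its free leaves if the centre is forced but the centre's parent is not. With no
such branch left, if `a` (or `b`) is forced, let `R` be its component in `S`: among the free
neighbours of `R`, take one whose component in `W \ R` is largest. If neither is forced, every
component that avoids `a` and `b` is small, and `a` or `b` itself works. -/

namespace SimpleGraph

/-! ### Components inside a vertex set. -/

variable {V : Type*} [Fintype V]

open Classical in
/-- The vertices that can be reached from `v` by walks whose later vertices all lie in `A`; for
`v ∈ A`, this is the component of `v` in the subgraph induced on `A`. -/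
noncomputable def componentIn (G : SimpleGraph V) (A : Finset V) (v : V) : Finset V :=
  {u | Relation.ReflTransGen (fun x y => G.Adj x y ∧ y ∈ A) v u}

section componentIn

variable {G : SimpleGraph V} {A B : Finset V} {u v w : V}

theorem mem_componentIn :
    u ∈ G.componentIn A v ↔ Relation.ReflTransGen (fun x y => G.Adj x y ∧ y ∈ A) v u := by
  simp [componentIn]

theorem self_mem_componentIn : v ∈ G.componentIn A v :=
  mem_componentIn.2 .refl

theorem mem_componentIn_of_adj (hu : u ∈ G.componentIn A v) (huw : G.Adj u w) (hw : w ∈ A) :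
    w ∈ G.componentIn A v :=
  mem_componentIn.2 ((mem_componentIn.1 hu).tail ⟨huw, hw⟩)

theorem componentIn_subset_of_closed {Z : Finset V} (hv : v ∈ Z)
    (h : ∀ u ∈ Z, ∀ w ∈ A, G.Adj u w → w ∈ Z) : G.componentIn A v ⊆ Z := by
  intro u hu
  rw [mem_componentIn] at hu
  induction hu with
  | refl => exact hv
  | tail _ h2 ih => exact h _ ih _ h2.2 h2.1

theorem componentIn_subset (hv : v ∈ A) : G.componentIn A v ⊆ A :=
  componentIn_subset_of_closed hv fun _ _ _ hw _ => hw

theorem componentIn_mono (hAB : A ⊆ B) : G.componentIn A v ⊆ G.componentIn B v :=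
  componentIn_subset_of_closed self_mem_componentIn
    fun _ hu _ hw huw => mem_componentIn_of_adj hu huw (hAB hw)

theorem componentIn_trans (hu : u ∈ G.componentIn A v) :
    G.componentIn A u ⊆ G.componentIn A v :=
  componentIn_subset_of_closed hu fun _ hx _ hw hxw => mem_componentIn_of_adj hx hxw hw

theorem mem_componentIn_symm (hv : v ∈ A) (hu : u ∈ G.componentIn A v) :
    v ∈ G.componentIn A u := by
  rw [mem_componentIn] at hu
  suffices h : u ∈ A ∧ v ∈ G.componentIn A u from h.2
  induction hu with
  | refl => exact ⟨hv, self_mem_componentIn⟩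
  | tail _ h2 ih =>
    exact ⟨h2.2, componentIn_trans (mem_componentIn_of_adj self_mem_componentIn h2.1.symm ih.1)
      ih.2⟩

theorem componentIn_eq (hv : v ∈ A) (hu : u ∈ G.componentIn A v) :
    G.componentIn A u = G.componentIn A v :=
  (componentIn_trans hu).antisymm (componentIn_trans (mem_componentIn_symm hv hu))

theorem componentIn_componentIn : G.componentIn A v ⊆ G.componentIn (G.componentIn A v) v := by
  intro u hu
  have hu' := mem_componentIn.1 hu
  clear hu
  induction hu' with
  | refl => exact self_mem_componentIn
  | tail h1 h2 ih =>
    exact mem_componentIn_of_adj ih h2.1 (mem_componentIn.2 (h1.tail h2))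

theorem isRIndependent_iff_componentIn {r : ℕ} :
    G.IsRIndependent r A ↔ ∀ v ∈ A, (G.componentIn A v).card ≤ r := by
  have key : ∀ v (hv : v ∈ A), (G.componentIn A v).card =
      ((G.induce (A : Set V)).connectedComponentMk ⟨v, hv⟩).supp.ncard := by
    intro v hv
    rw [← Set.ncard_image_of_injective _ Subtype.val_injective, ← Set.ncard_coe_finset]
    congr 1
    ext u
    simp only [Finset.mem_coe, Set.mem_image, ConnectedComponent.mem_supp_iff,
      ConnectedComponent.eq, Subtype.exists, exists_and_right, exists_eq_right]
    constructor
    · intro hu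
      rw [mem_componentIn] at hu
      induction hu with
      | refl => exact ⟨hv, Reachable.refl _⟩
      | tail _ h2 ih =>
        obtain ⟨hx, hr⟩ := ih
        refine ⟨h2.2, Reachable.trans (Adj.reachable ?_) hr⟩
        simpa using h2.1.symm
    · rintro ⟨hu, hr⟩
      have hr' := (SimpleGraph.reachable_iff_reflTransGen _ _).1 hr.symm
      clear hr
      rw [mem_componentIn]
      exact Relation.ReflTransGen.lift (p := fun x y => G.Adj x y ∧ y ∈ A) Subtype.val
        (fun x y hxy => ⟨by simpa using hxy, y.2⟩) _ _ hr'
  constructor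
  · intro h v hv
    rw [key v hv]
    exact h _
  · intro h C
    induction C using ConnectedComponent.ind with
    | h v => rw [← key v.1 v.2]; exact h _ v.2

/-- A component of the enlarged set that misses `y` is contained in a component of `A`, so only that
of `y` has to be checked. -/
theorem IsRIndependent.insert [DecidableEq V] {r : ℕ} {y : V} (hA : G.IsRIndependent r A)
    (hy : (G.componentIn (insert y A) y).card ≤ r) : G.IsRIndependent r (insert y A) := by
  rw [isRIndependent_iff_componentIn] at hA ⊢
  intro v hv
  by_cases hyv : y ∈ G.componentIn (Insert.insert y A) v
  · rwa [← componentIn_eq hv hyv]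
  · have hvy : v ≠ y := fun h => hyv (h ▸ self_mem_componentIn)
    have hvA : v ∈ A := (Finset.mem_insert.1 hv).resolve_left hvy
    refine (Finset.card_le_card (componentIn_subset_of_closed self_mem_componentIn ?_)).trans
      (hA v hvA)
    intro u hu w hw huw
    refine mem_componentIn_of_adj hu huw ((Finset.mem_insert.1 hw).resolve_left ?_)
    rintro rfl
    exact hyv (mem_componentIn_of_adj (componentIn_mono (Finset.subset_insert _ _) hu) huw hw)

end componentIn

end SimpleGraph

/-! ### Shellings from shedding vertices. -/

section Shelling

variable {V : Type*} [DecidableEq V]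

/-- A family of finite sets is rank-shellable if its maximal members are ranked by distinct natural
numbers so that ordering them by rank is a shelling. -/
def IsRankShellable (K : Set (Finset V)) : Prop :=
  ∃ ρ : Finset V → ℕ, (∀ E F, Maximal (· ∈ K) E → Maximal (· ∈ K) F → ρ E = ρ F → E = F) ∧
    ∀ E F, Maximal (· ∈ K) E → Maximal (· ∈ K) F → ρ E < ρ F →
      ∃ E', Maximal (· ∈ K) E' ∧ ρ E' < ρ F ∧ ∃ x ∈ F, x ∉ E ∧ F.erase x ⊆ E'

theorem isRankShellable_of_subsingleton {K : Set (Finset V)}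
    (h : ∀ E F, Maximal (· ∈ K) E → Maximal (· ∈ K) F → E = F) : IsRankShellable K :=
  ⟨fun _ => 0, fun E F hE hF _ => h E F hE hF, fun _ _ _ _ hlt => absurd hlt (lt_irrefl _)⟩

/-- By `hx`, the facets avoiding `x` are exactly those of the deletion, while the facets containing
`x` are those of the link with `x` added. List the former first, then the latter. -/
theorem IsRankShellable.of_shedding [Finite V] {K : Set (Finset V)} (x : V)
    (hK : IsLowerSet K)
    (hx : ∀ F, x ∉ F → insert x F ∈ K → ∃ y, y ≠ x ∧ y ∉ F ∧ insert y F ∈ K)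
    (hdel : IsRankShellable {A | A ∈ K ∧ x ∉ A})
    (hlink : IsRankShellable {A | x ∉ A ∧ insert x A ∈ K}) : IsRankShellable K := by
  have := Fintype.ofFinite V
  obtain ⟨ρ, hρi, hρ⟩ := hdel
  obtain ⟨τ, hτi, hτ⟩ := hlink
  have hd : ∀ F, x ∉ F → (Maximal (· ∈ K) F ↔ Maximal (· ∈ {A | A ∈ K ∧ x ∉ A}) F) := by
    intro F hxF
    constructor
    · intro h
      exact ⟨⟨h.1, hxF⟩, fun B hB hFB => h.2 hB.1 hFB⟩
    · intro h
      refine ⟨h.1.1, fun B hB hFB => ?_⟩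
      by_cases hxB : x ∈ B
      · exfalso
        obtain ⟨y, hyx, hyF, hy⟩ := hx F hxF
          (hK (Finset.insert_subset hxB hFB) hB)
        exact hyF (h.2 (y := insert y F) ⟨hy, by simp [hyx.symm, hxF]⟩ (Finset.subset_insert _ _)
          (Finset.mem_insert_self _ _))
      · exact h.2 ⟨hB, hxB⟩ hFB
  have hl : ∀ F, x ∈ F → (Maximal (· ∈ K) F ↔
      Maximal (· ∈ {A | x ∉ A ∧ insert x A ∈ K}) (F.erase x)) := by
    intro F hxF
    constructor
    · intro h
      refine ⟨⟨by simp, by simpa [Finset.insert_erase hxF] using h.1⟩, fun B hB hFB => ?_⟩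
      have := h.2 hB.2 (by
        rw [← Finset.insert_erase hxF]
        exact Finset.insert_subset_insert _ hFB)
      intro y hy
      exact Finset.mem_erase.2 ⟨fun h => hB.1 (h ▸ hy), this (Finset.mem_insert_of_mem hy)⟩
    · intro h
      refine ⟨by simpa [Finset.insert_erase hxF] using h.1.2, fun B hB hFB => ?_⟩
      have := h.2 (y := B.erase x)
        ⟨by simp, by simpa [Finset.insert_erase (hFB hxF)] using hB⟩
        (Finset.erase_subset_erase _ hFB)
      rw [← Finset.insert_erase hxF, ← Finset.insert_erase (hFB hxF)]
      exact Finset.insert_subset_insert _ this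
  obtain ⟨N, hN⟩ : ∃ N, ∀ F, ρ F < N :=
    ⟨Finset.univ.sup ρ + 1, fun F => Nat.lt_succ_of_le (Finset.le_sup (Finset.mem_univ F))⟩
  -- The shift by `N`, which exceeds every value of `ρ`, places the facets containing `x` last.
  refine ⟨fun F => if x ∈ F then N + τ (F.erase x) else ρ F, ?_, ?_⟩
  · intro E F hE hF h
    have hE' := hN E
    have hF' := hN F
    by_cases hxE : x ∈ E <;> by_cases hxF : x ∈ F <;> simp only [hxE, hxF, if_true, if_false] at h
    · have := hτi _ _ ((hl E hxE).1 hE) ((hl F hxF).1 hF) (by omega)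
      rw [← Finset.insert_erase hxE, this, Finset.insert_erase hxF]
    · omega
    · omega
    · exact hρi _ _ ((hd E hxE).1 hE) ((hd F hxF).1 hF) h
  · intro E F hE hF h
    have hE' := hN E
    have hF' := hN F
    by_cases hxE : x ∈ E <;> by_cases hxF : x ∈ F <;>
      simp only [hxE, hxF, if_true, if_false] at h ⊢
    · obtain ⟨E', hE'm, hlt, z, hz, hzE, hsub⟩ :=
        hτ _ _ ((hl E hxE).1 hE) ((hl F hxF).1 hF) (by omega)
      have hxE' : x ∉ E' := hE'm.1.1
      refine ⟨insert x E', (hl _ (by simp)).2 (by simpa [hxE'] using hE'm), ?_, z,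
        (Finset.mem_erase.1 hz).2, fun h' => hzE (Finset.mem_erase.2
          ⟨(Finset.mem_erase.1 hz).1, h'⟩), ?_⟩
      · simpa [hxE'] using hlt
      · intro y hy
        by_cases hyx : y = x
        · simp [hyx]
        · refine Finset.mem_insert_of_mem (hsub ?_)
          simp only [Finset.mem_erase] at hy ⊢
          tauto
    · omega
    -- For `x ∈ F` and `x ∉ E`, the removed vertex is `x` itself: `F.erase x` extends to a facet of
    -- the deletion, which is listed before `F`.
    · have hFx : F.erase x ∈ {A | A ∈ K ∧ x ∉ A} :=
        ⟨hK (Finset.erase_subset _ _) hF.1, by simp⟩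
      obtain ⟨E', hle, hE'm⟩ :=
        (Set.toFinite {A | A ∈ K ∧ x ∉ A}).exists_le_maximal hFx
      have hxE' : x ∉ E' := hE'm.1.2
      refine ⟨E', (hd E' hxE').2 hE'm, ?_, x, hxF, hxE, hle⟩
      simp only [hxE', if_false]
      have := hN E'
      omega
    · obtain ⟨E', hE'm, hlt, z, hz, hzE, hsub⟩ := hρ _ _ ((hd E hxE).1 hE) ((hd F hxF).1 hF) h
      have hxE' : x ∉ E' := hE'm.1.2
      exact ⟨E', (hd E' hxE').2 hE'm, by simpa [hxE'] using hlt, z, hz, hzE, hsub⟩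

theorem PreAbstractSimplicialComplex.isShellable_of_isRankShellable [Finite V]
    (K : PreAbstractSimplicialComplex V) (h : IsRankShellable {s | s = ∅ ∨ s ∈ K.faces}) :
    K.IsShellable := by
  obtain ⟨ρ, hi, hs⟩ := h
  have hfin : K.facets.Finite := Set.toFinite _
  set I : Finset ℕ := hfin.toFinset.image ρ with hI
  let e := I.orderIsoOfFin rfl
  have hex : ∀ k : Fin I.card, ∃ F, F ∈ K.facets ∧ ρ F = e k := by
    intro k
    have := (e k).2
    simp only [hI, Finset.mem_image, Set.Finite.mem_toFinset] at this
    exact this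
  choose F hF hρF using hex
  have hlt : ∀ j k, j < k ↔ ρ (F j) < ρ (F k) := by
    intro j k
    rw [hρF, hρF, Subtype.coe_lt_coe, OrderIso.lt_iff_lt]
  have hsurj : ∀ E ∈ K.facets, ∃ j, F j = E := by
    intro E hE
    obtain ⟨j, hj⟩ := e.surjective ⟨ρ E, by
      simp only [hI, Finset.mem_image, Set.Finite.mem_toFinset]; exact ⟨E, hE, rfl⟩⟩
    exact ⟨j, hi _ _ (hF j) hE (by rw [hρF, hj])⟩
  refine ⟨I.card, F, ?_, ?_, ?_⟩
  · intro j k hjk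
    have := hρF j
    rw [hjk, hρF k] at this
    exact (e.injective (Subtype.ext this)).symm
  · ext E
    exact ⟨fun ⟨j, hj⟩ => hj ▸ hF j, fun hE => hsurj E hE⟩
  · intro k hk A hA
    -- The hypothesis `0 < k` serves the case `A = ∅`, which must also lie in an earlier facet.
    have hA' : A ⊆ F k ∧ ∃ j < k, A ⊆ F j := by
      rcases hA.1 with rfl | hA1
      · exact ⟨Finset.empty_subset _, ⟨⟨0, by omega⟩, hk, Finset.empty_subset _⟩⟩
      · obtain ⟨⟨-, E, rfl, hE⟩, -, E', ⟨j, hj, rfl⟩, hE'⟩ := hA1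
        exact ⟨hE, j, hj, hE'⟩
    obtain ⟨hAk, j, hj, hAj⟩ := hA'
    obtain ⟨E', hE', hlt', x, hxk, hxj, hsub⟩ := hs _ _ (hF j) (hF k) ((hlt j k).1 hj)
    obtain ⟨l, rfl⟩ := hsurj E' hE'
    have hAx : A ⊆ (F k).erase x := fun y hy =>
      Finset.mem_erase.2 ⟨fun h => hxj (h ▸ hAj hy), hAk hy⟩
    have hle : (F k).erase x ⊆ A := by
      refine hA.2 ?_ hAx
      rcases ((F k).erase x).eq_empty_or_nonempty with h0 | h0
      · exact Or.inl h0
      · exact Or.inr ⟨⟨h0, F k, rfl, Finset.erase_subset _ _⟩, h0, F l,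
          ⟨l, (hlt l k).2 hlt', rfl⟩, hsub⟩
    rw [hAx.antisymm hle, dimFace, dimFace, Finset.card_erase_of_mem hxk,
      Nat.cast_sub (Finset.card_pos.2 ⟨x, hxk⟩)]
    simp

end Shelling

namespace SimpleGraph

/-! ### Three criteria for shedding vertices. -/

section Shedding

variable {V : Type*} [Fintype V] [DecidableEq V] {G : SimpleGraph V} {r : ℕ} {U S : Finset V}

/-- In the complex of those `A ⊆ U` for which `A ∪ S` is `r`-independent, `x` is a shedding vertex:
no facet of the deletion of `x` lies in the link of `x`. -/
def IsShedding (G : SimpleGraph V) (r : ℕ) (U S : Finset V) (x : V) : Prop :=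
  ∀ H, S ⊆ H → H ⊆ U ∪ S → x ∉ H → G.IsRIndependent r (insert x H) →
    ∃ y ∈ U, y ≠ x ∧ y ∉ H ∧ G.IsRIndependent r (insert y H)

/-- If nothing but `x` can be added to `H`, then `H` already contains every `z ∈ Z` other than `x`,
since such a `z` is light without `x`. Hence `Z ⊆ insert x H`, which is impossible. -/
theorem isShedding_of_heavy {Z : Finset V} {x : V} (hZW : Z ⊆ U ∪ S)
    (hZ : ¬ G.IsRIndependent r Z)
    (hlight : ∀ z ∈ Z, z ≠ x → (G.componentIn ((U ∪ S).erase x) z).card ≤ r) :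
    G.IsShedding r U S x := by
  intro H hSH hHW hxH hH
  by_contra hno
  push Not at hno
  refine hZ (hH.mono fun z hz => ?_)
  by_contra hzH
  rw [Finset.mem_insert, not_or] at hzH
  have hzU : z ∈ U := (Finset.mem_union.1 (hZW hz)).resolve_right fun h => hzH.2 (hSH h)
  refine hno z hzU hzH.1 hzH.2 ((hH.mono (Finset.subset_insert _ _)).insert
    ((Finset.card_le_card (componentIn_mono ?_)).trans (hlight z hz hzH.1)))
  intro w hw
  refine Finset.mem_erase.2 ⟨?_, ?_⟩
  · rintro rfl
    rcases Finset.mem_insert.1 hw with h | h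
    exacts [hzH.1 h.symm, hxH h]
  · exact Finset.insert_subset (hZW hz) hHW hw

/-- An exchange of leaves: the star `Z` is too large to lie in `insert x H`, and a missing leaf `z`
enlarges the component of `c` no more than `x` does. -/
theorem isShedding_of_pendant {Z : Finset V} {x c : V} (hZW : Z ⊆ U ∪ S) (hcard : r < Z.card)
    (hc : c ∈ S) (hadj : ∀ z ∈ Z, z ≠ c → G.Adj c z ∧ ∀ w, G.Adj z w → w = c)
    (hx : x ∈ Z) (hxc : x ≠ c) : G.IsShedding r U S x := by
  intro H hSH hHW hxH hH
  by_contra hno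
  push Not at hno
  have hcomp := isRIndependent_iff_componentIn.1 hH c (Finset.mem_insert_of_mem (hSH hc))
  obtain ⟨z, hz, hzH⟩ : ∃ z ∈ Z, z ∉ insert x H := by
    by_contra hcon
    push Not at hcon
    refine absurd (Finset.card_le_card fun z hz => ?_) (not_le.2 (hcomp.trans_lt hcard))
    by_cases hzc : z = c
    · exact hzc ▸ self_mem_componentIn
    · exact mem_componentIn_of_adj self_mem_componentIn (hadj z hz hzc).1 (hcon z hz)
  rw [Finset.mem_insert, not_or] at hzH
  have hzU : z ∈ U := (Finset.mem_union.1 (hZW hz)).resolve_right fun h => hzH.2 (hSH h)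
  have hzc : z ≠ c := fun h => hzH.2 (h ▸ hSH hc)
  refine hno z hzU hzH.1 hzH.2 ((hH.mono (Finset.subset_insert _ _)).insert ?_)
  have h1 : G.componentIn (insert z H) z ⊆ insert z (G.componentIn H c) := by
    refine componentIn_subset_of_closed (Finset.mem_insert_self _ _) fun u hu w hw huw => ?_
    rcases Finset.mem_insert.1 hw with rfl | hw
    · exact Finset.mem_insert_self _ _
    · refine Finset.mem_insert_of_mem ?_
      rcases Finset.mem_insert.1 hu with rfl | hu
      · rw [(hadj u hz hzc).2 w huw]
        exact self_mem_componentIn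
      · exact mem_componentIn_of_adj hu huw hw
  have h2 : insert x (G.componentIn H c) ⊆ G.componentIn (insert x H) c :=
    Finset.insert_subset (mem_componentIn_of_adj self_mem_componentIn (hadj x hx hxc).1
      (Finset.mem_insert_self _ _)) (componentIn_mono (Finset.subset_insert _ _))
  have h3 : x ∉ G.componentIn H c := fun h => hxH (componentIn_subset (hSH hc) h)
  calc _ ≤ _ := Finset.card_le_card h1
    _ ≤ (G.componentIn H c).card + 1 := Finset.card_insert_le _ _
    _ = (insert x (G.componentIn H c)).card := (Finset.card_insert_of_notMem h3).symm
    _ ≤ _ := Finset.card_le_card h2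
    _ ≤ r := hcomp

/-- Each component of `W \ R` that hangs on `R` at a free vertex does so only there (`htree`). Take
`x` with the largest one. If `x` were not shedding, some `H` would contain that whole component
except `x`, so replacing it by any other hanging component would leave the component of `a` with at
most `r` vertices, and another vertex could be added. -/
theorem exists_isShedding_of_root {a : V} (ha : a ∈ S)
    (htree : ∀ y ∈ U, (∃ ρ ∈ G.componentIn S a, G.Adj ρ y) →
      ∀ y' ∈ G.componentIn ((U ∪ S) \ G.componentIn S a) y,
        (∃ ρ ∈ G.componentIn S a, G.Adj ρ y') → y' = y)
    (hlight : ∀ z ∈ U ∪ S, a ∉ G.componentIn (U ∪ S) z → (G.componentIn (U ∪ S) z).card ≤ r)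
    (hlight' : ∀ y ∈ U, (∃ ρ ∈ G.componentIn S a, G.Adj ρ y) →
      ∀ z ∈ G.componentIn ((U ∪ S) \ G.componentIn S a) y, z ≠ y →
        (G.componentIn (((U ∪ S) \ G.componentIn S a).erase y) z).card ≤ r)
    (hdisj : Disjoint U S) (hS : G.IsRIndependent r S) (hW : ¬ G.IsRIndependent r (U ∪ S)) :
    ∃ x ∈ U, (∃ ρ ∈ G.componentIn S a, G.Adj ρ x) ∧ G.IsShedding r U S x := by
  classical
  set R := G.componentIn S a with hR
  set W := U ∪ S with hWdef
  have hRS : R ⊆ S := componentIn_subset ha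
  have hUR : ∀ y ∈ U, y ∉ R := fun y hy h => Finset.disjoint_left.1 hdisj hy (hRS h)
  have hUW : ∀ y ∈ U, y ∈ W \ R := fun y hy =>
    Finset.mem_sdiff.2 ⟨Finset.mem_union_left _ hy, hUR y hy⟩
  have hRadj : ∀ u ∈ R, ∀ w ∈ W, G.Adj u w → w ∈ R ∨ w ∈ U := by
    intro u hu w hw huw
    rcases Finset.mem_union.1 hw with h | h
    · exact Or.inr h
    · exact Or.inl (mem_componentIn_of_adj hu huw h)
  have hstep : ∀ y u w, u ∈ G.componentIn (W \ R) y → w ∈ W → G.Adj u w → w ∉ R →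
      w ∈ G.componentIn (W \ R) y := fun y u w hu hw huw hwR =>
    mem_componentIn_of_adj hu huw (Finset.mem_sdiff.2 ⟨hw, hwR⟩)
  set Y := U.filter fun y => ∃ ρ ∈ R, G.Adj ρ y with hY
  have hYmem : ∀ y, y ∈ Y ↔ y ∈ U ∧ ∃ ρ ∈ R, G.Adj ρ y := fun y => by simp [hY]
  rcases Y.eq_empty_or_nonempty with hYe | hYn
  · refine absurd (isRIndependent_iff_componentIn.2 fun v hv => ?_) hW
    by_cases hav : a ∈ G.componentIn W v
    · rw [← componentIn_eq hv hav]
      refine (Finset.card_le_card (componentIn_subset_of_closed self_mem_componentIn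
        fun u hu w hw huw => ?_)).trans (isRIndependent_iff_componentIn.1 hS a ha)
      refine (hRadj u hu w hw huw).resolve_right fun hwU => ?_
      have : w ∈ Y := (hYmem w).2 ⟨hwU, u, hu, huw⟩
      simp [hYe] at this
    · exact hlight v hv hav
  obtain ⟨x, hxY, hmax⟩ := Y.exists_max_image (fun y => (G.componentIn (W \ R) y).card) hYn
  obtain ⟨hxU, hxR⟩ := (hYmem x).1 hxY
  refine ⟨x, hxU, hxR, ?_⟩
  intro H hSH hHW hxH hH
  by_contra hno
  push Not at hno
  have hRH : R ⊆ H := hRS.trans hSH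
  have haR : a ∈ R := self_mem_componentIn
  have haH : a ∈ H := hSH ha
  have hadd : ∀ y ∈ U, y ≠ x → y ∉ H → r < (G.componentIn (insert y H) y).card := by
    intro y hyU hyx hyH
    by_contra hle
    exact hno y hyU hyx hyH ((hH.mono (Finset.subset_insert _ _)).insert (not_lt.1 hle))
  have hinsW : ∀ y ∈ U, insert y H ⊆ W := fun y hy =>
    Finset.insert_subset (Finset.mem_union_left _ hy) hHW
  have hWU : ∀ z ∈ W, z ∉ H → z ∈ U := fun z hz hzH =>
    (Finset.mem_union.1 hz).resolve_right fun h => hzH (hSH h)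
  have hbelow : ∀ z ∈ G.componentIn (W \ R) x, z ≠ x → z ∈ H := by
    intro z hz hzx
    by_contra hzH
    have hzW := Finset.mem_sdiff.1 (componentIn_subset (hUW x hxU) hz)
    have hzU := hWU z hzW.1 hzH
    refine absurd ((Finset.card_le_card (componentIn_subset_of_closed self_mem_componentIn
      fun u hu w hw huw => ?_)).trans (hlight' x hxU hxR z hz hzx)) (not_le.2 (hadd z hzU hzx hzH))
    have hwx : w ≠ x := by
      rintro rfl
      rcases Finset.mem_insert.1 hw with h | h
      exacts [hzx h.symm, hxH h]
    have huE := componentIn_subset (Finset.mem_erase.2 ⟨hzx, hUW z hzU⟩) hu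
    refine mem_componentIn_of_adj hu huw (Finset.mem_erase.2 ⟨hwx, Finset.mem_sdiff.2
      ⟨hinsW z hzU hw, fun hwR => ?_⟩⟩)
    exact (Finset.mem_erase.1 huE).1 (htree x hxU hxR u (componentIn_trans hz
      (componentIn_mono (Finset.erase_subset _ _) hu)) ⟨w, hwR, huw.symm⟩)
  -- The component of `a` in `H` cannot enter the part hanging at `x`, whose only contact with `R`
  -- is `x ∉ H`; adding `x` merges the two.
  have hslack : (G.componentIn H a).card + (G.componentIn (W \ R) x).card ≤ r := by
    have hd : Disjoint (G.componentIn H a) (G.componentIn (W \ R) x) := by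
      have hsub : G.componentIn H a ⊆ W \ G.componentIn (W \ R) x := by
        refine componentIn_subset_of_closed ?_ fun u hu w hw huw => ?_
        · refine Finset.mem_sdiff.2 ⟨hHW haH, fun h => ?_⟩
          exact (Finset.mem_sdiff.1 (componentIn_subset (hUW x hxU) h)).2 haR
        · refine Finset.mem_sdiff.2 ⟨hHW hw, fun h => ?_⟩
          rw [Finset.mem_sdiff] at hu
          by_cases huR : u ∈ R
          · exact hxH (htree x hxU hxR w h ⟨u, huR, huw⟩ ▸ hw)
          · exact hu.2 (hstep x w u h hu.1 huw.symm huR)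
      exact Finset.disjoint_left.2 fun v hv => (Finset.mem_sdiff.1 (hsub hv)).2
    rw [← Finset.card_union_of_disjoint hd]
    refine (Finset.card_le_card (Finset.union_subset (componentIn_mono
      (Finset.subset_insert _ _)) ?_)).trans
      (isRIndependent_iff_componentIn.1 hH a (Finset.mem_insert_of_mem haH))
    obtain ⟨ρ, hρ, hρx⟩ := hxR
    have hx1 : x ∈ G.componentIn (insert x H) a :=
      mem_componentIn_of_adj (componentIn_mono (hSH.trans (Finset.subset_insert _ _)) hρ) hρx
        (Finset.mem_insert_self _ _)
    refine (componentIn_componentIn.trans (componentIn_mono fun z hz => ?_)).trans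
      (componentIn_trans hx1)
    by_cases hzx : z = x
    · exact hzx ▸ Finset.mem_insert_self _ _
    · exact Finset.mem_insert_of_mem (hbelow z hz hzx)
  refine hW (hH.mono fun z hzW => ?_)
  by_contra hzH
  rw [Finset.mem_insert, not_or] at hzH
  have hzU := hWU z hzW hzH.2
  have haz : a ∈ G.componentIn W z := by
    by_contra haz
    exact absurd ((Finset.card_le_card (componentIn_mono (hinsW z hzU))).trans
      (hlight z hzW haz)) (not_le.2 (hadd z hzU hzH.1 hzH.2))
  have hcover : G.componentIn W a ⊆ R ∪ Y.biUnion fun y => G.componentIn (W \ R) y := by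
    refine componentIn_subset_of_closed (Finset.mem_union_left _ haR) fun u hu w hw huw => ?_
    by_cases hwR : w ∈ R
    · exact Finset.mem_union_left _ hwR
    refine Finset.mem_union_right _ (Finset.mem_biUnion.2 ?_)
    rcases Finset.mem_union.1 hu with hu | hu
    · have hwU := (hRadj u hu w hw huw).resolve_left hwR
      exact ⟨w, (hYmem w).2 ⟨hwU, u, hu, huw⟩, self_mem_componentIn⟩
    · obtain ⟨y, hy, huy⟩ := Finset.mem_biUnion.1 hu
      exact ⟨y, hy, hstep y u w huy hw huw hwR⟩
  have hz : z ∈ Y.biUnion fun y => G.componentIn (W \ R) y :=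
    (Finset.mem_union.1 (hcover (mem_componentIn_symm hzW haz))).resolve_left (hUR z hzU)
  obtain ⟨y, hy, hzy⟩ := Finset.mem_biUnion.1 hz
  have hsub : G.componentIn (insert z H) z ⊆ G.componentIn H a ∪ G.componentIn (W \ R) y := by
    refine componentIn_subset_of_closed (Finset.mem_union_right _ hzy) fun u hu w hw huw => ?_
    rcases Finset.mem_insert.1 hw with rfl | hwH
    · exact Finset.mem_union_right _ hzy
    · rcases Finset.mem_union.1 hu with hu | hu
      · exact Finset.mem_union_left _ (mem_componentIn_of_adj hu huw hwH)
      · by_cases hwR : w ∈ R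
        · exact Finset.mem_union_left _ (componentIn_mono hSH hwR)
        · exact Finset.mem_union_right _ (hstep y u w hu (hHW hwH) huw hwR)
  refine absurd ?_ (not_le.2 (hadd z hzU hzH.1 hzH.2))
  calc _ ≤ _ := Finset.card_le_card hsub
    _ ≤ (G.componentIn H a).card + (G.componentIn (W \ R) y).card := Finset.card_union_le _ _
    _ ≤ (G.componentIn H a).card + (G.componentIn (W \ R) x).card :=
        Nat.add_le_add_left (hmax y hy) _
    _ ≤ r := hslack

end Shedding

/-- Two different edges between a connected part of `A` and a connected part of `R` would close a
cycle: the second gives a detour around the bridge `ρy`. -/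
theorem IsAcyclic.eq_of_mem_componentIn {V : Type*} [Fintype V] {G : SimpleGraph V}
    (hG : G.IsAcyclic) {A R : Finset V} (hAR : Disjoint A R) {y y' ρ ρ' : V} (hy : y ∈ A)
    (hyy' : y' ∈ G.componentIn A y) (hρ : ρ ∈ R) (hρρ' : ρ ∈ G.componentIn R ρ')
    (hρ' : ρ' ∈ R) (h : G.Adj ρ y) (h' : G.Adj ρ' y') : y' = y := by
  by_contra hne
  have hyR : y ∉ R := Finset.disjoint_left.1 hAR hy
  have hρA : ρ ∉ A := Finset.disjoint_right.1 hAR hρ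
  have hbr := (isAcyclic_iff_forall_adj_isBridge.1 hG) h
  rw [isBridge_iff] at hbr
  -- Connections inside `B` survive the deletion of an edge with an end outside `B`.
  have key : ∀ (B : Finset V) (e : Sym2 V) (v u : V), v ∈ B → (∃ z ∈ e, z ∉ B) →
      u ∈ G.componentIn B v → (G \ fromEdgeSet {e}).Reachable v u := by
    rintro B e v u hv ⟨z, hz, hzB⟩ hu
    have hu' := mem_componentIn.1 hu
    clear hu
    suffices hh : u ∈ B ∧ (G \ fromEdgeSet {e}).Reachable v u from hh.2
    induction hu' with
    | refl => exact ⟨hv, Reachable.refl _⟩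
    | tail _ h2 ih =>
      refine ⟨h2.2, ih.2.trans (Adj.reachable ?_)⟩
      rw [sdiff_adj, fromEdgeSet_adj]
      refine ⟨h2.1, fun hcon => ?_⟩
      rw [← hcon.1, Sym2.mem_iff] at hz
      rcases hz with rfl | rfl
      exacts [hzB ih.1, hzB h2.2]
  refine hbr ((key R _ ρ' ρ hρ' ⟨y, by simp, hyR⟩ hρρ').symm.trans ?_)
  refine Reachable.trans ?_ (key A _ y y' hy ⟨ρ, by simp, hρA⟩ hyy').symm
  refine Adj.reachable ?_
  rw [sdiff_adj, fromEdgeSet_adj]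
  refine ⟨h', fun hcon => ?_⟩
  have := hcon.1
  rw [Set.mem_singleton_iff, Sym2.eq_iff] at this
  rcases this with ⟨-, h⟩ | ⟨h, -⟩
  · exact hne h
  · exact hyR (h ▸ hρ')

end SimpleGraph

/-! ### Birooted trees, branches and the invariant. -/

namespace SimpleGraph

/-- A tree with a central edge `ab` all of whose vertices are within distance two of `{a, b}`,
described by the map `p` that moves each vertex one step towards the central edge and swaps the
ends of that edge. -/
structure IsBirooted {V : Type*} (G : SimpleGraph V) (p : V → V) (a b : V) : Prop where
  adj_iff : ∀ u v, G.Adj u v ↔ p u = v ∨ p v = u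
  parent_left : p a = b
  parent_right : p b = a
  parent_parent : ∀ v, p (p v) = a ∨ p (p v) = b

/-- The part in `W` of the star of `x` and the vertices with parent `x`. -/
def branch {V : Type*} [DecidableEq V] (p : V → V) (W : Finset V) (x : V) : Finset V :=
  W.filter fun v => v = x ∨ p v = x

/-- The invariant of the decomposition: `W` is the set of remaining vertices, `S` that of the
vertices already put into the face. -/
structure IsAdmissible {V : Type*} [DecidableEq V] (p : V → V) (a b : V) (r : ℕ)
    (W S : Finset V) : Prop where
  parent_mem : ∀ v ∈ S, p v ≠ a → p v ≠ b → p v ∈ S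
  parent_mem_or : ∀ v ∈ S, v ≠ a → v ≠ b → (p v = a ∨ p v = b) →
    p v ∈ S ∨ r ≤ (branch p W v).card

namespace IsBirooted

variable {V : Type*} {G : SimpleGraph V} {p : V → V} {a b : V} {r : ℕ}

theorem symm (h : G.IsBirooted p a b) : G.IsBirooted p b a :=
  ⟨h.adj_iff, h.parent_right, h.parent_left, fun v => (h.parent_parent v).symm⟩

theorem adj (h : G.IsBirooted p a b) : G.Adj a b :=
  (h.adj_iff a b).2 (Or.inl h.parent_left)

theorem ne (h : G.IsBirooted p a b) : a ≠ b := h.adj.ne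

theorem adj_parent (h : G.IsBirooted p a b) (v : V) : G.Adj v (p v) :=
  (h.adj_iff _ _).2 (Or.inl rfl)

theorem eq_parent_of_adj (h : G.IsBirooted p a b) {z w : V} (ha : p z ≠ a) (hb : p z ≠ b)
    (hzw : G.Adj z w) : w = p z := by
  rcases (h.adj_iff z w).1 hzw with h1 | rfl
  · exact h1.symm
  · rcases h.parent_parent w with h1 | h1
    exacts [absurd h1 ha, absurd h1 hb]

theorem componentIn_subset_singleton [Fintype V] (h : G.IsBirooted p a b) {A : Finset V} {z : V}
    (ha : p z ≠ a) (hb : p z ≠ b) (hz : p z ∉ A) : G.componentIn A z ⊆ {z} := by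
  refine componentIn_subset_of_closed (Finset.mem_singleton_self _) fun u hu w hw huw => ?_
  rw [Finset.mem_singleton] at hu
  subst hu
  exact absurd (h.eq_parent_of_adj ha hb huw ▸ hw) hz

variable [DecidableEq V] {U S W : Finset V}

theorem mem_branch {x v : V} : v ∈ branch p W x ↔ v ∈ W ∧ (v = x ∨ p v = x) :=
  Finset.mem_filter

theorem branch_mono {A : Finset V} (hA : A ⊆ W) (x : V) : branch p A x ⊆ branch p W x :=
  Finset.filter_subset_filter _ hA

theorem branch_erase_of_notMem {x v : V} (hx : x ∉ branch p W v) :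
    branch p (W.erase x) v = branch p W v := by
  ext u
  simp only [mem_branch, Finset.mem_erase] at hx ⊢
  constructor
  · tauto
  · rintro ⟨hu, h⟩
    refine ⟨⟨?_, hu⟩, h⟩
    rintro rfl
    exact hx ⟨hu, h⟩

theorem isAdmissible_symm (hA : IsAdmissible p a b r W S) : IsAdmissible p b a r W S :=
  ⟨fun v hv h1 h2 => hA.1 v hv h2 h1, fun v hv h1 h2 h3 => hA.2 v hv h2 h1 h3.symm⟩

/-- Erasing `x` costs a branch at most one vertex, hence the strict inequality for the branches that
contain it. -/
theorem isAdmissible_erase {x : V} (hA : IsAdmissible p a b r W S)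
    (hx : ∀ v ∈ S, v ≠ a → v ≠ b → (p v = a ∨ p v = b) → p v ∉ S → x ∈ branch p W v →
      r < (branch p W v).card) : IsAdmissible p a b r (W.erase x) S := by
  refine ⟨hA.1, fun v hv ha hb hp => ?_⟩
  by_cases hpv : p v ∈ S
  · exact Or.inl hpv
  refine Or.inr ?_
  by_cases hxv : x ∈ branch p W v
  · have h1 := hx v hv ha hb hp hpv hxv
    have h2 : (branch p W v).erase x ⊆ branch p (W.erase x) v := by
      intro u hu
      simp only [mem_branch, Finset.mem_erase] at hu ⊢
      tauto
    have h3 := Finset.card_le_card h2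
    rw [Finset.card_erase_of_mem hxv] at h3
    omega
  · rw [branch_erase_of_notMem hxv]
    exact (hA.2 v hv ha hb hp).resolve_left hpv

theorem isAdmissible_insert {x : V} (hA : IsAdmissible p a b r W S)
    (h1 : p x ≠ a → p x ≠ b → p x ∈ S)
    (h2 : x ≠ a → x ≠ b → (p x = a ∨ p x = b) → p x ∈ S ∨ r ≤ (branch p W x).card) :
    IsAdmissible p a b r W (insert x S) := by
  refine ⟨fun v hv ha hb => ?_, fun v hv ha hb hp => ?_⟩
  · refine Finset.mem_insert_of_mem ?_
    rcases Finset.mem_insert.1 hv with rfl | hv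
    exacts [h1 ha hb, hA.1 v hv ha hb]
  · refine Or.imp_left Finset.mem_insert_of_mem ?_
    rcases Finset.mem_insert.1 hv with rfl | hv
    exacts [h2 ha hb hp, hA.2 v hv ha hb hp]

/-! ### Finding a shedding vertex in a birooted tree. -/

variable [Fintype V]

theorem componentIn_subset_branch (h : G.IsBirooted p a b) {A : Finset V} {x v : V}
    (ha : x ≠ a) (hb : x ≠ b) (hxA : x ∈ A) (hx : p x ∉ A) (hv : v ∈ branch p A x) :
    G.componentIn A v ⊆ branch p A x := by
  refine componentIn_subset_of_closed hv fun u hu w hw huw => ?_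
  rw [mem_branch] at hu ⊢
  refine ⟨hw, ?_⟩
  rcases hu.2 with rfl | rfl
  · rcases (h.adj_iff _ _).1 huw with rfl | h1
    · exact absurd hw hx
    · exact Or.inr h1
  · exact Or.inl (h.eq_parent_of_adj ha hb huw)

theorem branch_subset_componentIn (h : G.IsBirooted p a b) {x : V} :
    branch p W x ⊆ G.componentIn (branch p W x) x := by
  intro v hv
  rcases (mem_branch.1 hv).2 with rfl | h1
  · exact self_mem_componentIn
  · exact mem_componentIn_of_adj self_mem_componentIn ((h.adj_iff _ _).2 (Or.inr h1)) hv

/-- A component that contains neither end of the central edge is small if the branches are. -/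
theorem card_componentIn_le (h : G.IsBirooted p a b) (hr : 1 ≤ r) {A : Finset V} {z : V}
    (hz : z ∈ A) (ha : a ∉ G.componentIn A z) (hb : b ∉ G.componentIn A z)
    (hA : ∀ x ∈ A, x ≠ a → x ≠ b → (p x = a ∨ p x = b) → p x ∉ A → (branch p A x).card ≤ r) :
    (G.componentIn A z).card ≤ r := by
  have hnot : ∀ x ∈ G.componentIn A z, (p x = a ∨ p x = b) → p x ∉ A := by
    intro x hx hpx hmem
    have := mem_componentIn_of_adj hx (h.adj_parent x) hmem
    rcases hpx with h1 | h1 <;> rw [h1] at this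
    exacts [ha this, hb this]
  have hne : ∀ x ∈ G.componentIn A z, x ≠ a ∧ x ≠ b := fun x hx =>
    ⟨fun h1 => ha (h1 ▸ hx), fun h1 => hb (h1 ▸ hx)⟩
  have hzz : z ∈ G.componentIn A z := self_mem_componentIn
  by_cases hm : p z = a ∨ p z = b
  · exact (Finset.card_le_card (h.componentIn_subset_branch (hne z hzz).1 (hne z hzz).2 hz
      (hnot z hzz hm) (mem_branch.2 ⟨hz, Or.inl rfl⟩))).trans
      (hA z hz (hne z hzz).1 (hne z hzz).2 hm (hnot z hzz hm))
  · rw [not_or] at hm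
    by_cases hpz : p z ∈ A
    · have hpzc := mem_componentIn_of_adj hzz (h.adj_parent z) hpz
      have hpp := hnot _ hpzc (h.parent_parent z)
      exact (Finset.card_le_card (h.componentIn_subset_branch hm.1 hm.2 hpz hpp
        (mem_branch.2 ⟨hz, Or.inr rfl⟩))).trans (hA _ hpz hm.1 hm.2 (h.parent_parent z) hpp)
    · exact (Finset.card_le_card (h.componentIn_subset_singleton hm.1 hm.2 hpz)).trans (by simpa)

theorem isShedding_of_heavy_side (h : G.IsBirooted p a b) (hr : 1 ≤ r)
    (ha : a ∈ U) (hW : ∀ x ∈ U ∪ S, x ≠ a → x ≠ b → (p x = a ∨ p x = b) →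
      (branch p (U ∪ S) x).card ≤ r)
    (hheavy : r < (G.componentIn ((U ∪ S).erase b) a).card) : G.IsShedding r U S a := by
  have haW : a ∈ (U ∪ S).erase b := Finset.mem_erase.2 ⟨h.ne, Finset.mem_union_left _ ha⟩
  have hZ := componentIn_subset (G := G) haW
  -- The condition describes the side of `a` of the central edge. Since `p` swaps `a` and `b`, the
  -- vertex `b` and its children have to be excluded explicitly.
  have hside : ∀ u w, (u = a ∨ u ≠ b ∧ (p u = a ∨ p u ≠ b ∧ p (p u) = a)) → G.Adj u w → w ≠ b →
      (w = a ∨ w ≠ b ∧ (p w = a ∨ p w ≠ b ∧ p (p w) = a)) := by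
    intro u w hu huw hwb
    rcases (h.adj_iff u w).1 huw with h1 | h1
    · rcases hu with rfl | ⟨-, h2 | ⟨h2, h3⟩⟩
      · exact absurd (h1.symm.trans h.parent_left) hwb
      · exact Or.inl (h1.symm.trans h2)
      · exact Or.inr ⟨hwb, Or.inl (h1 ▸ h3)⟩
    · rcases hu with rfl | ⟨hub, h2 | ⟨h2, h3⟩⟩
      · exact Or.inr ⟨hwb, Or.inl h1⟩
      · exact Or.inr ⟨hwb, Or.inr ⟨h1 ▸ hub, h1 ▸ h2⟩⟩
      · rcases h.parent_parent w with h4 | h4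
        · rw [h1] at h4
          rw [h4, h.parent_left] at h3
          exact absurd h3.symm h.ne
        · exact absurd (h1 ▸ h4) h2
  have hne : ∀ u w, u ≠ a → (u = a ∨ u ≠ b ∧ (p u = a ∨ p u ≠ b ∧ p (p u) = a)) →
      G.Adj u w → w ≠ b := by
    rintro u w hua hu huw rfl
    rcases (h.adj_iff u w).1 huw with h1 | h1
    · rcases hu with hu | ⟨-, h2 | ⟨h2, -⟩⟩
      exacts [hua hu, h.ne (h2.symm.trans h1), h2 h1]
    · exact hua (h1.symm.trans h.parent_right)
  refine isShedding_of_heavy (hZ.trans (Finset.erase_subset _ _)) (fun hind => ?_) fun z hz hza => ?_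
  · refine absurd (isRIndependent_iff_componentIn.1 hind a self_mem_componentIn) (not_le.2 ?_)
    exact hheavy.trans_le (Finset.card_le_card componentIn_componentIn)
  · have hzside : z ∈ Finset.univ.filter fun z =>
        (z = a ∨ z ≠ b ∧ (p z = a ∨ p z ≠ b ∧ p (p z) = a)) := by
      refine componentIn_subset_of_closed ?_ (fun u hu w hw huw => ?_) hz
      · simp
      · simp only [Finset.mem_filter, Finset.mem_univ, true_and] at hu ⊢
        exact hside u w hu huw (Finset.mem_erase.1 hw).1
    have hsub : G.componentIn ((U ∪ S).erase a) z ⊆ Finset.univ.filter fun z =>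
        z ≠ a ∧ z ≠ b ∧ (z = a ∨ z ≠ b ∧ (p z = a ∨ p z ≠ b ∧ p (p z) = a)) := by
      refine componentIn_subset_of_closed ?_ fun u hu w hw huw => ?_
      · have hzb := (Finset.mem_erase.1 (hZ hz)).1
        simp only [Finset.mem_filter, Finset.mem_univ, true_and] at hzside ⊢
        exact ⟨hza, hzb, hzside⟩
      · simp only [Finset.mem_filter, Finset.mem_univ, true_and] at hu ⊢
        have hwb := hne u w hu.1 hu.2.2 huw
        exact ⟨(Finset.mem_erase.1 hw).1, hwb, hside u w hu.2.2 huw hwb⟩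
    refine h.card_componentIn_le hr
      (Finset.mem_erase.2 ⟨hza, (Finset.mem_erase.1 (hZ hz)).2⟩)
      (fun hmem => by simpa using hsub hmem) (fun hmem => by simpa using hsub hmem) ?_
    intro x hx hxa hxb hxp _
    exact (Finset.card_le_card (branch_mono (Finset.erase_subset _ _) x)).trans
      (hW x (Finset.mem_erase.1 hx).2 hxa hxb hxp)

/-- If a side with free root is heavy, that root is shedding. Otherwise every component of `W`
without `a` is light, so `a` is shedding with `Z = W`. -/
theorem exists_isShedding_of_mem (h : G.IsBirooted p a b) (hr : 1 ≤ r)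
    (ha : a ∈ U) (hbS : b ∉ S)
    (hW : ∀ x ∈ U ∪ S, x ≠ a → x ≠ b → (p x = a ∨ p x = b) →
      (branch p (U ∪ S) x).card ≤ r)
    (hind : ¬ G.IsRIndependent r (U ∪ S)) :
    ∃ x ∈ U, (x = a ∨ x = b) ∧ G.IsShedding r U S x := by
  by_cases hha : r < (G.componentIn ((U ∪ S).erase b) a).card
  · exact ⟨a, ha, Or.inl rfl, h.isShedding_of_heavy_side hr ha hW hha⟩
  by_cases hhb : b ∈ U ∧ r < (G.componentIn ((U ∪ S).erase a) b).card
  · exact ⟨b, hhb.1, Or.inr rfl, h.symm.isShedding_of_heavy_side hr hhb.1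
      (fun x hx h1 h2 h3 => hW x hx h2 h1 h3.symm) hhb.2⟩
  refine ⟨a, ha, Or.inl rfl, isShedding_of_heavy subset_rfl hind fun z hz hza => ?_⟩
  have hzA : z ∈ (U ∪ S).erase a := Finset.mem_erase.2 ⟨hza, hz⟩
  by_cases hbz : b ∈ G.componentIn ((U ∪ S).erase a) z
  · rw [← componentIn_eq hzA hbz]
    have hbU : b ∈ U := (Finset.mem_union.1 (Finset.mem_erase.1
      (componentIn_subset hzA hbz)).2).resolve_right hbS
    exact not_lt.1 fun hlt => hhb ⟨hbU, hlt⟩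
  · refine h.card_componentIn_le hr hzA
      (fun hmem => (Finset.mem_erase.1 (componentIn_subset hzA hmem)).1 rfl) hbz ?_
    intro x hx hxa hxb hxp _
    exact (Finset.card_le_card (branch_mono (Finset.erase_subset _ _) x)).trans
      (hW x (Finset.mem_erase.1 hx).2 hxa hxb hxp)

theorem exists_isShedding_of_notMem (h : G.IsBirooted p a b) (hr : 1 ≤ r)
    (haS : a ∉ S) (hbS : b ∉ S)
    (hW : ∀ x ∈ U ∪ S, x ≠ a → x ≠ b → (p x = a ∨ p x = b) →
      (branch p (U ∪ S) x).card ≤ r)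
    (hind : ¬ G.IsRIndependent r (U ∪ S)) :
    ∃ x ∈ U, (x = a ∨ x = b) ∧ G.IsShedding r U S x := by
  by_cases ha : a ∈ U
  · exact h.exists_isShedding_of_mem hr ha hbS hW hind
  by_cases hb : b ∈ U
  · obtain ⟨x, hx, hxab, hs⟩ := h.symm.exists_isShedding_of_mem hr hb haS
      (fun x hx h1 h2 h3 => hW x hx h2 h1 h3.symm) hind
    exact ⟨x, hx, hxab.symm, hs⟩
  refine absurd (isRIndependent_iff_componentIn.2 fun z hz => ?_) hind
  refine h.card_componentIn_le hr hz ?_ ?_ fun x hx hxa hxb hxp _ => hW x hx hxa hxb hxp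
  · intro hmem
    rcases Finset.mem_union.1 (componentIn_subset hz hmem) with h1 | h1
    exacts [ha h1, haS h1]
  · intro hmem
    rcases Finset.mem_union.1 (componentIn_subset hz hmem) with h1 | h1
    exacts [hb h1, hbS h1]

theorem exists_isShedding_of_mem_forced (h : G.IsBirooted p a b) (hG : G.IsAcyclic) (hr : 1 ≤ r)
    (ha : a ∈ S) (hdisj : Disjoint U S)
    (hU : ∀ x ∈ U, x ≠ a → x ≠ b → (p x = a ∨ p x = b) → (branch p (U ∪ S) x).card ≤ r)
    (hS : ∀ x ∈ S, x ≠ a → x ≠ b → (p x = a ∨ p x = b) → p x ∉ S →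
      (branch p (U ∪ S) x).card ≤ r)
    (hSind : G.IsRIndependent r S) (hind : ¬ G.IsRIndependent r (U ∪ S)) :
    ∃ x ∈ U, (∃ ρ ∈ G.componentIn S a, G.Adj ρ x) ∧ G.IsShedding r U S x := by
  have haW : a ∈ U ∪ S := Finset.mem_union_right _ ha
  have haR : a ∈ G.componentIn S a := self_mem_componentIn
  have hUR : ∀ y ∈ U, y ∈ (U ∪ S) \ G.componentIn S a := fun y hy =>
    Finset.mem_sdiff.2 ⟨Finset.mem_union_left _ hy, fun hyR =>
      Finset.disjoint_left.1 hdisj hy (componentIn_subset ha hyR)⟩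
  have htree : ∀ y ∈ U, (∃ ρ ∈ G.componentIn S a, G.Adj ρ y) →
      ∀ y' ∈ G.componentIn ((U ∪ S) \ G.componentIn S a) y,
        (∃ ρ ∈ G.componentIn S a, G.Adj ρ y') → y' = y := by
    rintro y hy ⟨ρ, hρ, hρy⟩ y' hy' ⟨ρ', hρ', hρy'⟩
    exact hG.eq_of_mem_componentIn Finset.sdiff_disjoint (hUR y hy) hy' hρ
      (componentIn_trans (mem_componentIn_symm haR (componentIn_componentIn hρ'))
        (componentIn_componentIn hρ)) hρ' hρy hρy'
  refine exists_isShedding_of_root ha htree ?_ ?_ hdisj hSind hind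
  · intro z hz haz
    refine h.card_componentIn_le hr hz haz
      (fun hb => haz (mem_componentIn_of_adj hb h.adj.symm haW)) ?_
    intro x hx hxa hxb hxp hpx
    rcases Finset.mem_union.1 hx with hx | hx
    · exact hU x hx hxa hxb hxp
    · exact hS x hx hxa hxb hxp fun hmem => hpx (Finset.mem_union_right _ hmem)
  · intro y hy hyR z hz hzy
    have hzA : z ∈ ((U ∪ S) \ G.componentIn S a).erase y :=
      Finset.mem_erase.2 ⟨hzy, componentIn_subset (hUR y hy) hz⟩
    refine h.card_componentIn_le hr hzA (fun hmem => ?_) (fun hmem => ?_) ?_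
    · exact (Finset.mem_sdiff.1 (Finset.mem_erase.1 (componentIn_subset hzA hmem)).2).2 haR
    -- If `b` is in the hanging component, it is adjacent to `a ∈ R`, so it is the contact vertex
    -- `y`, which was erased.
    · exact (Finset.mem_erase.1 (componentIn_subset hzA hmem)).1 (htree y hy hyR b
        (componentIn_trans hz (componentIn_mono (Finset.erase_subset _ _) hmem))
        ⟨a, haR, h.adj⟩)
    · intro x hx hxa hxb hxp _
      have hx' := Finset.mem_sdiff.1 (Finset.mem_erase.1 hx).2
      refine (Finset.card_le_card (branch_mono (W := U ∪ S)
        ((Finset.erase_subset _ _).trans Finset.sdiff_subset) x)).trans ?_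
      rcases Finset.mem_union.1 hx'.1 with hxU | hxS
      · exact hU x hxU hxa hxb hxp
      -- If the parent of `x` were forced, it would lie in `R`, as `b` is joined to `a`; then `x`
      -- would lie in `R` too.
      · refine hS x hxS hxa hxb hxp fun hpS => hx'.2 ?_
        have hpR : p x ∈ G.componentIn S a := by
          rcases hxp with h1 | h1 <;> rw [h1] at hpS ⊢
          · exact haR
          · exact mem_componentIn_of_adj haR h.adj hpS
        exact mem_componentIn_of_adj hpR (h.adj_parent x).symm hxS

theorem exists_step_of_mem_forced (h : G.IsBirooted p a b) (hG : G.IsAcyclic) (hr : 1 ≤ r)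
    (ha : a ∈ S) (hdisj : Disjoint U S) (hA : IsAdmissible p a b r (U ∪ S) S)
    (hU : ∀ x ∈ U, x ≠ a → x ≠ b → (p x = a ∨ p x = b) → (branch p (U ∪ S) x).card ≤ r)
    (hS : ∀ x ∈ S, x ≠ a → x ≠ b → (p x = a ∨ p x = b) → p x ∉ S →
      (branch p (U ∪ S) x).card ≤ r)
    (hSind : G.IsRIndependent r S) (hind : ¬ G.IsRIndependent r (U ∪ S)) :
    ∃ x ∈ U, G.IsShedding r U S x ∧ IsAdmissible p a b r ((U ∪ S).erase x) S ∧
      IsAdmissible p a b r (U ∪ S) (insert x S) := by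
  obtain ⟨x, hxU, ⟨ρ, hρ, hρx⟩, hx⟩ :=
    h.exists_isShedding_of_mem_forced hG hr ha hdisj hU hS hSind hind
  have hxS : x ∉ S := Finset.disjoint_left.1 hdisj hxU
  have hρS : ρ ∈ S := componentIn_subset ha hρ
  refine ⟨x, hxU, hx, isAdmissible_erase hA ?_, isAdmissible_insert hA ?_ ?_⟩
  · intro v hv hva hvb hpv hpvS hxv
    exfalso
    rcases (mem_branch.1 hxv).2 with rfl | rfl
    · exact hxS hv
    · rw [h.eq_parent_of_adj hva hvb hρx.symm] at hρ
      have h1 := h.componentIn_subset_branch hva hvb hv hpvS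
        (mem_branch.2 ⟨hv, Or.inl rfl⟩) (mem_componentIn_symm ha hρ)
      rcases (mem_branch.1 h1).2 with h2 | h2
      · exact hva h2.symm
      · exact hvb (h2.symm.trans h.parent_left)
  · intro hpa hpb
    exact h.eq_parent_of_adj hpa hpb hρx.symm ▸ hρS
  · intro hxa hxb hxp
    rcases (h.adj_iff _ _).1 hρx with h1 | h1
    · exact absurd (h1 ▸ hA.parent_mem ρ hρS (h1 ▸ hxa) (h1 ▸ hxb)) hxS
    · exact Or.inl (h1 ▸ hρS)

theorem exists_step (h : G.IsBirooted p a b) (hG : G.IsAcyclic) (hr : 1 ≤ r)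
    (hdisj : Disjoint U S) (hA : IsAdmissible p a b r (U ∪ S) S)
    (hSind : G.IsRIndependent r S) (hind : ¬ G.IsRIndependent r (U ∪ S)) :
    ∃ x ∈ U, G.IsShedding r U S x ∧ IsAdmissible p a b r ((U ∪ S).erase x) S ∧
      IsAdmissible p a b r (U ∪ S) (insert x S) := by
  by_cases hU : ∀ x ∈ U, x ≠ a → x ≠ b → (p x = a ∨ p x = b) → (branch p (U ∪ S) x).card ≤ r
  swap
  · push Not at hU
    obtain ⟨x, hxU, hxa, hxb, hxp, hxr⟩ := hU
    have hxS : x ∉ S := Finset.disjoint_left.1 hdisj hxU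
    refine ⟨x, hxU, isShedding_of_heavy (Z := branch p (U ∪ S) x) (Finset.filter_subset _ _)
      (fun hZ => ?_) (fun z hz hzx => ?_), isAdmissible_erase hA ?_,
      isAdmissible_insert hA ?_ fun _ _ _ => Or.inr hxr.le⟩
    · refine absurd (isRIndependent_iff_componentIn.1 hZ x
        (mem_branch.2 ⟨Finset.mem_union_left _ hxU, Or.inl rfl⟩)) (not_le.2 (hxr.trans_le ?_))
      exact Finset.card_le_card h.branch_subset_componentIn
    · have hpz := (mem_branch.1 hz).2.resolve_left hzx
      subst hpz
      exact (Finset.card_le_card (h.componentIn_subset_singleton hxa hxb (by simp))).trans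
        (by simpa)
    · intro v hv hva hvb _ _ hxv
      exfalso
      rcases (mem_branch.1 hxv).2 with rfl | rfl
      · exact hxS hv
      · exact hxp.elim hva hvb
    · exact fun h1 h2 => (hxp.elim h1 h2).elim
  by_cases hS : ∀ x ∈ S, x ≠ a → x ≠ b → (p x = a ∨ p x = b) → p x ∉ S →
      (branch p (U ∪ S) x).card ≤ r
  swap
  · push Not at hS
    obtain ⟨c, hcS, hca, hcb, hcp, hpc, hcr⟩ := hS
    have hcb' : c ∈ branch p (U ∪ S) c := mem_branch.2 ⟨Finset.mem_union_right _ hcS, Or.inl rfl⟩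
    obtain ⟨x, hx, hxS⟩ : ∃ x ∈ branch p (U ∪ S) c, x ∉ S := by
      by_contra hcon
      push Not at hcon
      exact absurd (isRIndependent_iff_componentIn.1 hSind c hcS) (not_le.2 (hcr.trans_le
        (Finset.card_le_card (h.branch_subset_componentIn.trans (componentIn_mono hcon)))))
    have hxc : x ≠ c := fun h1 => hxS (h1 ▸ hcS)
    have hpx : p x = c := (mem_branch.1 hx).2.resolve_left hxc
    have hxU : x ∈ U := (Finset.mem_union.1 (mem_branch.1 hx).1).resolve_right hxS
    refine ⟨x, hxU, isShedding_of_pendant (Finset.filter_subset _ _) hcr hcS (fun z hz hzc => ?_)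
      hx hxc, isAdmissible_erase hA ?_, isAdmissible_insert hA ?_ ?_⟩
    · have hpz := (mem_branch.1 hz).2.resolve_left hzc
      subst hpz
      exact ⟨(h.adj_parent z).symm, fun w hw => h.eq_parent_of_adj hca hcb hw⟩
    · intro v hv _ _ _ _ hxv
      rcases (mem_branch.1 hxv).2 with rfl | hv'
      · exact absurd hv hxS
      · rw [← hv', hpx]
        exact hcr
    · exact fun _ _ => hpx ▸ hcS
    · exact fun _ _ _ => Or.inl (hpx ▸ hcS)
  by_cases haS : a ∈ S
  · exact h.exists_step_of_mem_forced hG hr haS hdisj hA hU hS hSind hind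
  by_cases hbS : b ∈ S
  · obtain ⟨x, hx, h1, h2, h3⟩ := h.symm.exists_step_of_mem_forced hG hr hbS hdisj
      (isAdmissible_symm hA) (fun x hx h1 h2 h3 => hU x hx h2 h1 h3.symm)
      (fun x hx h1 h2 h3 => hS x hx h2 h1 h3.symm) hSind hind
    exact ⟨x, hx, h1, isAdmissible_symm h2, isAdmissible_symm h3⟩
  have hW : ∀ x ∈ U ∪ S, x ≠ a → x ≠ b → (p x = a ∨ p x = b) →
      (branch p (U ∪ S) x).card ≤ r := by
    intro x hx hxa hxb hxp
    rcases Finset.mem_union.1 hx with hx | hx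
    · exact hU x hx hxa hxb hxp
    · refine hS x hx hxa hxb hxp ?_
      rcases hxp with h1 | h1 <;> rwa [h1]
  obtain ⟨x, hxU, hxab, hx⟩ := h.exists_isShedding_of_notMem hr haS hbS hW hind
  have hpx : p x = a ∨ p x = b := by
    rcases hxab with rfl | rfl
    exacts [Or.inr h.parent_left, Or.inl h.parent_right]
  refine ⟨x, hxU, hx, isAdmissible_erase hA ?_, isAdmissible_insert hA ?_ ?_⟩
  · intro v _ hva hvb _ _ hxv
    exfalso
    rcases (mem_branch.1 hxv).2 with rfl | rfl
    · exact hxab.elim hva hvb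
    · exact hpx.elim hva hvb
  · exact fun h1 h2 => (hpx.elim h1 h2).elim
  · exact fun h1 h2 => (hxab.elim h1 h2).elim

/-! ### The induction on the number of free vertices. -/

theorem isRankShellable (h : G.IsBirooted p a b) (hG : G.IsAcyclic) (hr : 1 ≤ r)
    (hdisj : Disjoint U S) (hA : IsAdmissible p a b r (U ∪ S) S) :
    IsRankShellable {A | A ⊆ U ∧ G.IsRIndependent r (A ∪ S)} := by
  induction hn : U.card generalizing U S with
  | zero =>
    rw [Finset.card_eq_zero] at hn
    subst hn
    refine isRankShellable_of_subsingleton fun E F hE hF => ?_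
    rw [Finset.subset_empty.1 hE.1.1, Finset.subset_empty.1 hF.1.1]
  | succ n ih =>
    by_cases hSind : G.IsRIndependent r S
    swap
    · refine isRankShellable_of_subsingleton fun E F hE _ => ?_
      exact absurd (hE.1.2.mono Finset.subset_union_right) hSind
    by_cases hind : G.IsRIndependent r (U ∪ S)
    · refine isRankShellable_of_subsingleton fun E F hE hF => ?_
      have hU : U ∈ {A | A ⊆ U ∧ G.IsRIndependent r (A ∪ S)} := ⟨subset_rfl, hind⟩
      rw [(hE.2 hU hE.1.1).antisymm' hE.1.1, (hF.2 hU hF.1.1).antisymm' hF.1.1]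
    obtain ⟨x, hxU, hx, hdel, hlink⟩ := h.exists_step hG hr hdisj hA hSind hind
    have hxS : x ∉ S := Finset.disjoint_left.1 hdisj hxU
    have hcard : (U.erase x).card = n := by rw [Finset.card_erase_of_mem hxU, hn]; rfl
    have hW1 : U.erase x ∪ S = (U ∪ S).erase x := by
      rw [Finset.erase_union_distrib, Finset.erase_eq_of_notMem hxS]
    have hW2 : U.erase x ∪ insert x S = U ∪ S := by
      rw [Finset.union_insert, ← Finset.insert_union, Finset.insert_erase hxU]
    have ih1 := ih (U := U.erase x) (S := S) (hdisj.mono_left (Finset.erase_subset _ _))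
      (by rwa [hW1]) hcard
    have ih2 := ih (U := U.erase x) (S := insert x S)
      (Finset.disjoint_insert_right.2
        ⟨by simp, hdisj.mono_left (Finset.erase_subset _ _)⟩) (by rwa [hW2]) hcard
    refine IsRankShellable.of_shedding x ?_ ?_ ?_ ?_
    · exact fun A B hBA hAm =>
        ⟨hBA.trans hAm.1, hAm.2.mono (Finset.union_subset_union_left hBA)⟩
    · rintro F hxF ⟨hFU, hF⟩
      have hFU' := (Finset.subset_insert x F).trans hFU
      obtain ⟨y, hyU, hyx, hyF, hy⟩ := hx (F ∪ S) Finset.subset_union_right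
        (Finset.union_subset_union_left hFU') (by simp [hxF, hxS])
        (by rwa [← Finset.insert_union])
      exact ⟨y, hyx, fun hmem => hyF (Finset.mem_union_left _ hmem),
        Finset.insert_subset hyU hFU', by rwa [Finset.insert_union]⟩
    · convert ih1 using 2
      ext A
      simp only [Set.mem_ofPred_eq, Finset.subset_erase]
      tauto
    · convert ih2 using 2
      ext A
      simp only [Set.mem_ofPred_eq, Finset.subset_erase, Finset.insert_subset_iff, hxU,
        true_and, Finset.insert_union, Finset.union_insert]
      tauto

end IsBirooted
end SimpleGraph

/-! ### Central edges of trees of small diameter. -/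

namespace SimpleGraph

theorem IsAcyclic.exists_isBirooted {V : Type*} [Finite V] {G : SimpleGraph V}
    (hG : G.IsAcyclic) {a b : V} (hab : G.Adj a b) (h : V → ℕ)
    (h0 : ∀ v, h v = 0 ↔ v = a ∨ v = b) (h2 : ∀ v, h v ≤ 2)
    (hdown : ∀ v, h v ≠ 0 → ∃ u, G.Adj v u ∧ h u + 1 = h v) :
    ∃ p, G.IsBirooted p a b := by
  classical
  have := Fintype.ofFinite V
  choose! q hq hqh using hdown
  let p : V → V := fun v => if v = a then b else if v = b then a else q v
  have hpa : p a = b := if_pos rfl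
  have hpb : p b = a := by simp [p, hab.ne.symm]
  have hpq : ∀ v, h v ≠ 0 → p v = q v := by
    intro v hv
    rw [ne_eq, h0, not_or] at hv
    simp [p, hv.1, hv.2]
  have hpadj : ∀ v, G.Adj v (p v) := by
    intro v
    by_cases hv : h v = 0
    · rcases (h0 v).1 hv with rfl | rfl
      · rw [hpa]; exact hab
      · rw [hpb]; exact hab.symm
    · rw [hpq v hv]; exact hq v hv
  have hph : ∀ v, h v ≠ 0 → h (p v) + 1 = h v := fun v hv => by rw [hpq v hv, hqh v hv]
  -- A descending path from `x` avoids `u`, because the heights drop strictly and start at most at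
  -- `h u`.
  have hreach : ∀ u, h u ≠ 0 → ∀ n x, h x = n → x ≠ u → h x ≤ h u →
      x ∈ G.componentIn (Finset.univ.erase u) a := by
    intro u hu n
    induction n with
    | zero =>
      intro x hx hxu _
      rcases (h0 x).1 hx with rfl | rfl
      · exact self_mem_componentIn
      · exact mem_componentIn_of_adj self_mem_componentIn hab (by simp [hxu])
    | succ n ih =>
      intro x hx hxu hle
      have hp := hph x (by omega)
      refine mem_componentIn_of_adj (ih (p x) (by omega) ?_ (by omega)) (hpadj x).symm
        (by simp [hxu])
      rintro hpu
      rw [hpu] at hp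
      omega
  have huniq : ∀ u v, h u ≠ 0 → h v ≤ h u → G.Adj u v → p u = v := by
    intro u v hu hle huv
    have hp := hph u hu
    have hau : a ≠ u := by
      rintro rfl
      exact hu ((h0 _).2 (Or.inl rfl))
    refine hG.eq_of_mem_componentIn (A := Finset.univ.erase u) (R := {u}) (by simp)
      (by simp [huv.ne.symm])
      ?_ (Finset.mem_singleton_self u) self_mem_componentIn (Finset.mem_singleton_self u) huv
      (hpadj u)
    exact componentIn_trans (mem_componentIn_symm (by simp [hau])
      (hreach u hu _ v rfl huv.ne.symm hle)) (hreach u hu _ (p u) rfl (hpadj u).ne.symm (by omega))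
  refine ⟨p, fun u v => ⟨fun huv => ?_, ?_⟩, hpa, hpb, fun v => ?_⟩
  · rcases le_total (h v) (h u) with hle | hle
    · by_cases hu : h u = 0
      · have hv : h v = 0 := by omega
        rcases (h0 u).1 hu with rfl | rfl <;> rcases (h0 v).1 hv with rfl | rfl
        · exact absurd huv G.irrefl
        · exact Or.inl hpa
        · exact Or.inl hpb
        · exact absurd huv G.irrefl
      · exact Or.inl (huniq u v hu hle huv)
    · by_cases hv : h v = 0
      · have hu : h u = 0 := by omega
        rcases (h0 u).1 hu with rfl | rfl <;> rcases (h0 v).1 hv with rfl | rfl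
        · exact absurd huv G.irrefl
        · exact Or.inl hpa
        · exact Or.inl hpb
        · exact absurd huv G.irrefl
      · exact Or.inr (huniq v u hv hle huv.symm)
  · rintro (rfl | rfl)
    exacts [hpadj u, (hpadj v).symm]
  · by_cases hv : h v = 0
    · rcases (h0 v).1 hv with rfl | rfl
      · left; rw [hpa, hpb]
      · right; rw [hpb, hpa]
    · have h1 := hph v hv
      have h3 := h2 v
      by_cases hpv : h (p v) = 0
      · rcases (h0 _).1 hpv with h4 | h4
        · right; rw [h4, hpa]
        · left; rw [h4, hpb]
      · have h4 := hph (p v) hpv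
        exact (h0 _).1 (by omega)

/-- The bridge `ab` separates `v` from `w`, so a geodesic between them passes through `a`. -/
theorem IsTree.dist_add_dist_le_of_adj {V : Type*} {G : SimpleGraph V} (hG : G.IsTree)
    {a b v w : V} (hab : G.Adj a b) (hv : G.dist v a < G.dist v b)
    (hw : G.dist w b < G.dist w a) : G.dist v a + G.dist a w ≤ G.dist v w := by
  classical
  have hreach : ∀ {x c d : V}, G.dist x c < G.dist x d →
      (G.deleteEdges {s(c, d)}).Reachable x c := by
    intro x c d hlt
    obtain ⟨q, hq⟩ := hG.connected.exists_walk_length_eq_dist x c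
    rw [reachable_deleteEdges_iff_exists_walk]
    refine ⟨q, fun he => ?_⟩
    have hd := q.snd_mem_support_of_mem_edges he
    have := (G.dist_le (q.takeUntil d hd)).trans (q.length_takeUntil_le_length hd)
    omega
  have hbr := isBridge_iff.1 (isAcyclic_iff_forall_adj_isBridge.1 hG.isAcyclic hab)
  have hwb := hreach hw
  rw [Sym2.eq_swap] at hwb
  obtain ⟨q, hq⟩ := hG.connected.exists_walk_length_eq_dist v w
  have he : s(a, b) ∈ q.edges := by
    by_contra he
    exact hbr ((hreach hv).symm.trans
      ((reachable_deleteEdges_iff_exists_walk.2 ⟨q, he⟩).trans hwb))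
  have ha := q.fst_mem_support_of_mem_edges he
  have h1 := G.dist_le (q.takeUntil a ha)
  have h2 := G.dist_le (q.dropUntil a ha)
  have h3 := congrArg Walk.length (q.take_spec ha)
  rw [Walk.length_append] at h3
  omega

theorem IsTree.exists_isBirooted_of_diam_le {V : Type*} [Finite V] [Nontrivial V]
    {G : SimpleGraph V} (hG : G.IsTree) (hdiam : G.diam ≤ 5) :
    ∃ (p : V → V) (a b : V), G.IsBirooted p a b := by
  have htop : G.ediam ≠ ⊤ := connected_iff_ediam_ne_top.1 hG.connected
  have hd0 := diam_ne_zero_of_ediam_ne_top htop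
  have hle : ∀ u v, G.dist u v ≤ G.diam := fun u v => dist_le_diam htop
  obtain ⟨u, w, huw⟩ := G.exists_dist_eq_diam
  obtain ⟨q, hq⟩ := hG.connected.exists_walk_length_eq_dist u w
  -- The edge starts at position `diam - 3` of a longest geodesic, leaving at most two steps on
  -- either side; truncated subtraction covers diameters one and two.
  obtain ⟨i, hi⟩ : ∃ i, i = G.diam - 3 := ⟨_, rfl⟩
  have hlt : i < q.length := by omega
  obtain ⟨a, ha⟩ : ∃ a, a = q.getVert i := ⟨_, rfl⟩
  obtain ⟨b, hb⟩ : ∃ b, b = q.getVert (i + 1) := ⟨_, rfl⟩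
  have hab : G.Adj a b := ha ▸ hb ▸ q.adj_getVert_succ hlt
  have hua : G.dist u a ≤ i := by
    have := G.dist_le (q.take i)
    rw [Walk.take_length, ← ha] at this
    omega
  have hbw : G.dist b w ≤ G.diam - (i + 1) := by
    have := G.dist_le (q.drop (i + 1))
    rw [Walk.drop_length, ← hb] at this
    omega
  have hab1 : G.dist a b = 1 := dist_eq_one_iff_adj.2 hab
  have t1 := hG.connected.dist_triangle (u := u) (v := a) (w := w)
  have t2 := hG.connected.dist_triangle (u := a) (v := b) (w := w)
  have t3 := hG.connected.dist_triangle (u := u) (v := b) (w := w)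
  have c1 : G.dist b u = G.dist u b := dist_comm
  have c2 : G.dist w a = G.dist a w := dist_comm
  have c3 : G.dist w b = G.dist b w := dist_comm
  -- A vertex further away than this would be at distance more than `diam` from the end of the
  -- geodesic on the other side.
  have hbound : ∀ v, min (G.dist v a) (G.dist v b) ≤ 2 := by
    intro v
    rcases lt_or_gt_of_ne (hG.dist_ne_of_adj v hab) with hv | hv
    · have h1 := hG.dist_add_dist_le_of_adj hab hv (w := w) (by omega)
      have h2 := hle v w
      omega
    · have h1 := hG.dist_add_dist_le_of_adj hab.symm hv (w := u) (by omega)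
      have h2 := hle v u
      omega
  have hdown : ∀ v c, G.dist v c ≠ 0 → ∃ x, G.Adj v x ∧ G.dist x c + 1 = G.dist v c := by
    intro v c hvc
    obtain ⟨q, hq⟩ := hG.connected.exists_walk_length_eq_dist v c
    cases q with
    | nil => simp at hvc
    | @cons _ x _ hadj q' =>
      refine ⟨x, hadj, ?_⟩
      have h1 := G.dist_le q'
      have h2 := hG.connected.dist_triangle (u := v) (v := x) (w := c)
      have h3 : G.dist v x = 1 := dist_eq_one_iff_adj.2 hadj
      rw [Walk.length_cons] at hq
      omega
  obtain ⟨p, hp⟩ := hG.isAcyclic.exists_isBirooted hab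
    (fun v => min (G.dist v a) (G.dist v b)) (fun v => by
      simp [hG.connected.dist_eq_zero_iff]) hbound (fun v hv => by
      rcases lt_or_gt_of_ne (hG.dist_ne_of_adj v hab) with hlt' | hlt'
      · obtain ⟨x, hx, hxd⟩ := hdown v a (by omega)
        have := hG.connected.dist_triangle (u := v) (v := x) (w := b)
        have h3 : G.dist v x = 1 := dist_eq_one_iff_adj.2 hx
        exact ⟨x, hx, by omega⟩
      · obtain ⟨x, hx, hxd⟩ := hdown v b (by omega)
        have := hG.connected.dist_triangle (u := v) (v := x) (w := a)
        have h3 : G.dist v x = 1 := dist_eq_one_iff_adj.2 hx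
        exact ⟨x, hx, by omega⟩)
  exact ⟨p, a, b, hp⟩

end SimpleGraph

theorem theorem4p9 {V : Type*} [Finite V] (G : SimpleGraph V) (hG : G.IsTree) (hdiam : G.diam ≤ 5)
    (r : ℕ) (hr : 2 ≤ r) :
    (G.rIndependenceComplex r (le_trans one_le_two hr)).toPreAbstractSimplicialComplex.IsShellable :=
  by
  classical
  have := Fintype.ofFinite V
  have hr1 : 1 ≤ r := one_le_two.trans hr
  refine PreAbstractSimplicialComplex.isShellable_of_isRankShellable _ ?_
  have hfaces : {s | s = ∅ ∨ s ∈ (G.rIndependenceComplex r hr1).faces} =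
      {A | A ⊆ Finset.univ ∧ G.IsRIndependent r (A ∪ ∅)} := by
    ext A
    simp only [SimpleGraph.rIndependenceComplex, Set.mem_ofPred_eq, Finset.subset_univ, true_and,
      Finset.union_empty]
    constructor
    · rintro (rfl | h)
      exacts [G.isRIndependent_of_card_le (by simp), h.2]
    · exact fun h => A.eq_empty_or_nonempty.imp_right fun hA => ⟨hA, h⟩
  refine hfaces ▸ ?_
  -- A tree with one vertex has no central edge, but its complex is a simplex.
  by_cases hV : ∀ x y : V, x = y
  · refine isRankShellable_of_subsingleton fun E F hE hF => ?_
    have huniv : (Finset.univ : Finset V) ∈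
        {A | A ⊆ Finset.univ ∧ G.IsRIndependent r (A ∪ ∅)} :=
      ⟨subset_rfl, G.isRIndependent_of_card_le (by
        rw [Finset.union_empty]
        exact (Finset.card_le_one.2 fun x _ y _ => hV x y).trans hr1)⟩
    rw [Finset.univ_subset_iff.1 (hE.2 huniv (Finset.subset_univ _)),
      Finset.univ_subset_iff.1 (hF.2 huniv (Finset.subset_univ _))]
  · push Not at hV
    have : Nontrivial V := ⟨hV⟩
    obtain ⟨p, a, b, hp⟩ := hG.exists_isBirooted_of_diam_le hdiam
    exact hp.isRankShellable hG.isAcyclic hr1 (Finset.disjoint_empty_right _)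
      ⟨by simp, by simp⟩
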